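/- Let $V$ be a finite set. For a directed acyclic graph (DAG) $G$ on $V$, write $\mathrm{pa}_G(v)$ for the set of parents of $v$; call $A\subseteq V$ ancestral in $G$ if $\mathrm{pa}_G(v)\subseteq A$ for all $v\in A$. The semi-graphoid of $G$ is the set of triples $(A,B,C)$ of subsets of $V$ such that $C$ separates $A$ from $B$ in the moral graph of the subgraph of $G$ induced by the smallest ancestral set containing $A\cup B\cup C$. Two DAGs on $V$ are Markov equivalent if they have the same semi-graphoid; a dagoid on $V$ is a Markov equivalence class $[G]$ of DAGs on $V$, and $\mathfrak D$ denotes the (finite) set of all dagoids on $V$. A set $A\subseteq V$ is ancestral in a dagoid $D$ if it is ancestral in some $G\in D$; let $\mathfrak D_{\mathrm{anc}}(A)$ be the set of dagoids on $V$ in which $A$ is ancestral. For $D\in\mathfrak D_{\mathrm{anc}}(A)$ and any $G\in D$ in which $A$ is ancestral, let $D_A$ be the Markov equivalence class of the induced subgraph $G_A$ (a dagoid on $A$), and let $D_{V\mid A}$ be the Markov equivalence class of the DAG obtained from $G$ by replacing all edges between elements of $A$ by those of a complete DAG on $A$; neither depends on the choices made. A graph law is a probability distribution $\pi$ on $\mathfrak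 D$. It is (dagoid) structurally Markov if for every $A\subseteq V$, when $D\sim\pi$, the random dagoids $D_{V\mid A}$ and $D_A$ are conditionally independent given the event $D\in\mathfrak D_{\mathrm{anc}}(A)$. The d-clique vector of $D=[G]$ is $$t(D)=\sum_{v\in V}\bigl[\delta(\{v\}\cup\mathrm{pa}_G(v))-\delta(\mathrm{pa}_G(v))\bigr]+\delta(\varnothing)\in\mathbb Z^{2^V},\qquad \delta(A)=(\mathbf 1_{S=A})_{S\subseteq V},$$ which does not depend on the choice of $G\in D$. Theorem. Let $\pi$ be a graph law whose support is all of $\mathfrak D$, i.e. $\pi(D)>0$ for every dagoid $D$ on $V$. Then $\pi$ is structurally Markov if and only if it belongs to the exponential family with the d-clique vector as natural statistic, that is, if and only if there is $\omega\in\mathbb R^{2^V}$ such that $\pi(D)\propto\exp\{\omega\cdot t(D)\}$ for $D\in\mathfrak D$. -/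

import Mathlib

/-- A directed acyclic graph (DAG) with vertex set `V`: a digraph that admits a compatible
well-ordering `r`, i.e. `r u v` holds for every arrow `u → v`. -/
structure Dag (V : Type*) extends Digraph V where
  acyclic : ∃ r : V → V → Prop, IsWellOrder V r ∧ ∀ u v, Adj u v → r u v

namespace Dag

variable {V : Type*}

/-- The set of parents of a vertex. -/
def parents (G : Dag V) (v : V) : Set V := {u | G.Adj u v}

/-- A set of vertices is ancestral if it contains all parents of its elements. -/
def IsAncestral (G : Dag V) (A : Set V) : Prop := ∀ v ∈ A, G.parents v ⊆ A

/-- The smallest ancestral set that contains `B`. -/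
def ancestralHull (G : Dag V) (B : Set V) : Set V := ⋂₀ {U | G.IsAncestral U ∧ B ⊆ U}

/-- The moral graph of the subgraph of `G` induced by `U`: two distinct vertices of `U` are joined
if there is an arrow between them or if they have a common child in `U`. It is regarded as a graph
on all of `V`, in which the vertices outside `U` are isolated. -/
def moralOn (G : Dag V) (U : Set V) : SimpleGraph V where
  Adj u v := u ≠ v ∧ u ∈ U ∧ v ∈ U ∧
    (G.Adj u v ∨ G.Adj v u ∨ ∃ w ∈ U, G.Adj u w ∧ G.Adj v w)
  symm := ⟨fun u v ⟨hne, hu, hv, h⟩ => ⟨hne.symm, hv, hu, by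
    rcases h with h | h | ⟨w, hw, h₁, h₂⟩
    · exact Or.inr (Or.inl h)
    · exact Or.inl h
    · exact Or.inr (Or.inr ⟨w, hw, h₂, h₁⟩)⟩⟩
  loopless := ⟨fun _ h => h.1 rfl⟩

end Dag

/-- `C` separates `A` from `B` in an undirected graph: every path (of any length, zero included)
from an element of `A` to an element of `B` contains an element of `C`. -/
def SimpleGraph.SeparatedBy {V : Type*} (G : SimpleGraph V) (A B C : Set V) : Prop :=
  ∀ a ∈ A, ∀ b ∈ B, ∀ p : G.Walk a b, ∃ c ∈ C, c ∈ p.support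

namespace Dag

variable {V : Type*}

/-- The semi-graphoid of a DAG: the triples `(A, B, C)`, meaning `A ⊥ B | C`, such that `C`
separates `A` from `B` in the moral graph of the subgraph induced by the smallest ancestral set
containing `A ∪ B ∪ C`. -/
def semigraphoid (G : Dag V) : Set (Set V × Set V × Set V) :=
  {T | (G.moralOn (G.ancestralHull (T.1 ∪ T.2.1 ∪ T.2.2))).SeparatedBy T.1 T.2.1 T.2.2}

/-- Markov equivalence of DAGs: equality of their semi-graphoids. -/
instance markovSetoid (V : Type*) : Setoid (Dag V) := Setoid.ker semigraphoid

/-- The induced subgraph on `A`. -/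
def induce (G : Dag V) (A : Set V) : Dag A where
  Adj u v := G.Adj u v
  acyclic := by
    obtain ⟨r, hr, h⟩ := G.acyclic
    exact ⟨Subrel r (· ∈ A), inferInstance, fun u v huv => h u v huv⟩

/-- A complete DAG on `V`, with exactly one arrow between any two distinct vertices (all complete
DAGs on `V` are Markov equivalent). -/
noncomputable def complete (V : Type*) : Dag V where
  Adj u v := WellOrderingRel u v
  acyclic := ⟨WellOrderingRel, inferInstance, fun _ _ h => h⟩

open Classical in
/-- The insertion of a DAG `H` on `A` into a DAG `G` in which `A` is ancestral: the arrows between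
elements of `A` are those of `H`, all other arrows are those of `G`. -/
noncomputable def insertion {A : Set V} (H : Dag A) (G : Dag V) (hA : G.IsAncestral A) : Dag V where
  Adj u v := (∃ (hu : u ∈ A) (hv : v ∈ A), H.Adj ⟨u, hu⟩ ⟨v, hv⟩) ∨
    (G.Adj u v ∧ ¬ (u ∈ A ∧ v ∈ A))
  acyclic := by
    obtain ⟨r, hr, hG⟩ := G.acyclic
    obtain ⟨s, hs, hH⟩ := H.acyclic
    let f : V → A ⊕ V := fun v => if h : v ∈ A then Sum.inl ⟨v, h⟩ else Sum.inr v
    have hf : Function.Injective f := by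
      intro u v huv
      by_cases hu : u ∈ A <;> by_cases hv : v ∈ A <;> simp_all [f]
    refine ⟨f ⁻¹'o Sum.Lex s r, (RelEmbedding.preimage ⟨f, hf⟩ (Sum.Lex s r)).isWellOrder, ?_⟩
    rintro u v (⟨hu, hv, h⟩ | ⟨h, hn⟩)
    · simpa [f, hu, hv] using hH _ _ h
    · by_cases hv : v ∈ A
      · exact absurd ⟨hA v hv h, hv⟩ hn
      · by_cases hu : u ∈ A
        · simp [f, hu, hv]
        · simpa [f, hu, hv] using hG _ _ h

open Classical in
/-- The d-clique vector `∑ᵥ (δ({v} ∪ pa(v)) - δ(pa(v))) + δ(∅)`, where `δ(A)` is the indicator of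
the coordinate `A`. -/
noncomputable def dCliqueVector [Fintype V] (G : Dag V) : Set V → ℤ :=
  ∑ v, (Pi.single (insert v (G.parents v)) 1 - Pi.single (G.parents v) 1) + Pi.single ∅ 1

end Dag

/-- A dagoid: a Markov equivalence class of DAGs on `V`. -/
def Dagoid (V : Type*) : Type _ := Quotient (Dag.markovSetoid V)

namespace Dagoid

variable {V : Type*}

/-- The Markov equivalence class of a DAG. -/
def mk (G : Dag V) : Dagoid V := Quotient.mk _ G

/-- Every set of dagoids is an event. -/
instance : MeasurableSpace (Dagoid V) := ⊤

/-- The set of dagoids in which `A` is ancestral, i.e. ancestral in some DAG of the class. -/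
def ances (A : Set V) : Set (Dagoid V) := {D | ∃ G : Dag V, mk G = D ∧ G.IsAncestral A}

/-- A member of the class `D` in which `A` is ancestral. -/
noncomputable def rep {A : Set V} (D : ances A) : Dag V := D.2.choose

theorem isAncestral_rep {A : Set V} (D : ances A) : (rep D).IsAncestral A := D.2.choose_spec.2

/-- The subdagoid `D_A` induced by an ancestral set `A`: the class of `G_A`, for a member `G` of
`D` in which `A` is ancestral (the class does not depend on `G`). -/
noncomputable def induced {A : Set V} (D : ances A) : Dagoid A := mk ((rep D).induce A)

/-- The remainder dagoid `D_{V|A}`: the class of the insertion of a complete DAG on `A` into `G`,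
for a member `G` of `D` in which `A` is ancestral (the class does not depend on `G`). -/
noncomputable def remainder {A : Set V} (D : ances A) : Dagoid V :=
  mk ((Dag.complete A).insertion (rep D) (isAncestral_rep D))

/-- The d-clique vector of a dagoid: that of a member (it is the same for all members). -/
noncomputable def dCliqueVector [Fintype V] (D : Dagoid V) : Set V → ℤ :=
  (Quotient.out D).dCliqueVector

end Dagoid

open ProbabilityTheory in
/-- The dagoid structural Markov property of a graph law: for every set `A` of vertices, `D_{V|A}`
and `D_A` are independent conditionally on the event that `A` is ancestral in `D`. The conditional
law given this event is regarded as a law on the event. -/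
def IsStructurallyMarkov {V : Type*} (law : PMF (Dagoid V)) : Prop :=
  ∀ A : Set V,
    IndepFun (Dagoid.remainder (A := A)) (Dagoid.induced (A := A))
      ((law.toMeasure[|Dagoid.ances A]).comap Subtype.val)

/-- Membership in the exponential family with the d-clique vector as natural statistic: the
density (with respect to counting measure) is proportional to `exp (ω · t(D))` for some real
vector `ω` indexed by the subsets of `V`. -/
def IsDCliqueExponential {V : Type*} [Fintype V] (law : PMF (Dagoid V)) : Prop :=
  ∃ ω : Set V → ℝ, ∃ c : ℝ, 0 < c ∧ ∀ D : Dagoid V,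
    (law D).toReal = c * Real.exp (∑ A, ω A * (D.dCliqueVector A : ℝ))

/-!
Independence of `D_{V|A}` and `D_A` on the event that `A` is ancestral amounts to the relation
`law [G] * law [H] = law [G'] * law [H']`, where `G'` and `H'` arise from `G` and `H` by an exchange
of the subgraphs on `A`. The dagoids `[G']` and `[H']` depend only on those of `G` and `H`, because
Markov equivalent DAGs are those with the same skeleton and immoralities, and two of these are
connected by reversals of covered arrows. The exchange permutes the parent sets, so the relation
holds for every law in the exponential family.

Conversely, let `v` have no children in `G` and let `P` be its set of parents. The relation for
`A = V ∖ {v}` and a DAG `H` that is complete on `P` and has no other arrows shows that deleting the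
arrows into `v` lowers `log law` by `ω (P ∪ {v}) - ω P`, where `ω B` is the log-probability of the
dagoid that is complete on `B` only. Iteration down to the DAG without arrows gives `ω · t`.
-/

namespace Dag

variable {V : Type*} {G H : Dag V}

theorem ext_parents (h : ∀ v, G.parents v = H.parents v) : G = H := by
  obtain ⟨⟨adjG⟩, _⟩ := G
  obtain ⟨⟨adjH⟩, _⟩ := H
  obtain rfl : adjG = adjH := by
    ext u v
    exact Set.ext_iff.1 (h v) u
  rfl

instance [Finite V] : Finite (Dag V) :=
  Finite.of_injective parents fun _ _ h => ext_parents (congrFun h)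

theorem wellFounded_adj (G : Dag V) : WellFounded G.Adj :=
  have ⟨_, hr, h⟩ := G.acyclic
  Subrelation.wf (h _ _) hr.wf

theorem wellFounded_flip_adj [Finite V] (G : Dag V) : WellFounded fun u v => G.Adj v u := by
  have : IsTrans V (flip (Relation.TransGen G.Adj)) := ⟨fun _ _ _ huv hvw => hvw.trans huv⟩
  have : Std.Irrefl (flip (Relation.TransGen G.Adj)) := ⟨G.wellFounded_adj.transGen.irrefl.irrefl⟩
  exact Subrelation.wf Relation.TransGen.single
    (Finite.wellFounded_of_trans_of_irrefl (flip (Relation.TransGen G.Adj)))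

/-- The DAG whose arrows are given by a well-founded relation; every DAG is of this form. -/
def ofWellFounded (R : V → V → Prop) (hR : WellFounded R) : Dag V where
  Adj := R
  acyclic :=
    have : IsWellFounded V R := ⟨hR⟩
    have ⟨r, hRr, hr⟩ := IsWellFounded.exists_well_order_ge R
    ⟨r, hr, hRr⟩

theorem irrefl (G : Dag V) (u : V) : ¬ G.Adj u u := G.wellFounded_adj.irrefl.irrefl u

theorem asymm {u v : V} (h : G.Adj u v) : ¬ G.Adj v u := G.wellFounded_adj.asymmetric u v h

theorem not_adj_of_adj_of_adj {u v w : V} (huv : G.Adj u v) (hvw : G.Adj v w) : ¬ G.Adj w u :=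
  G.wellFounded_adj.asymmetric₃ u v w huv hvw

theorem subset_ancestralHull (G : Dag V) (B : Set V) : B ⊆ G.ancestralHull B :=
  Set.subset_sInter fun _ h => h.2

theorem ancestralHull_subset {B U : Set V} (hU : G.IsAncestral U) (h : B ⊆ U) :
    G.ancestralHull B ⊆ U :=
  Set.sInter_subset_of_mem ⟨hU, h⟩

theorem isAncestral_ancestralHull (G : Dag V) (B : Set V) : G.IsAncestral (G.ancestralHull B) :=
  fun v hv _ hu U hU => hU.1 v (hv U hU) hu

theorem IsAncestral.ancestralHull_eq {U : Set V} (hU : G.IsAncestral U) : G.ancestralHull U = U :=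
  (ancestralHull_subset hU subset_rfl).antisymm (G.subset_ancestralHull U)

theorem IsAncestral.insert_parents_subset {U : Set V} (hU : G.IsAncestral U) {v : V} (hv : v ∈ U) :
    insert v (G.parents v) ⊆ U :=
  Set.insert_subset hv (hU v hv)

theorem isAncestral_setOf_not_reflTransGen (G : Dag V) (w : V) :
    G.IsAncestral {z | ¬ Relation.ReflTransGen G.Adj w z} :=
  fun _ hz _ hadj hw => hz (hw.tail hadj)

theorem isAncestral_compl_singleton_iff {v : V} : G.IsAncestral {v}ᶜ ↔ ∀ w, ¬ G.Adj v w := by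
  constructor
  · intro h w hvw
    refine h w ?_ hvw rfl
    rintro rfl
    exact G.irrefl w hvw
  · rintro h w - u huw rfl
    exact h w huw

theorem notMem_ancestralHull_pair {u v w : V} (huw : G.Adj u w) (hvw : G.Adj v w) :
    w ∉ G.ancestralHull {u, v} := by
  have not_reach : ∀ z, G.Adj z w → ¬ Relation.ReflTransGen G.Adj w z := fun z hzw hwz =>
    G.wellFounded_adj.transGen.irrefl.irrefl w (.tail' hwz hzw)
  have hsub : ({u, v} : Set V) ⊆ {z | ¬ Relation.ReflTransGen G.Adj w z} :=
    Set.pair_subset (not_reach u huw) (not_reach v hvw)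
  exact fun hw => ancestralHull_subset (G.isAncestral_setOf_not_reflTransGen w) hsub hw .refl

/-! ### Separation in moral graphs -/

theorem moralOn_adj_iff {U : Set V} {u v : V} :
    (G.moralOn U).Adj u v ↔ u ≠ v ∧ u ∈ U ∧ v ∈ U ∧
      ∃ w ∈ U, u ∈ insert w (G.parents w) ∧ v ∈ insert w (G.parents w) := by
  simp only [moralOn, parents, Set.mem_insert_iff, Set.mem_ofPred_eq]
  constructor
  · rintro ⟨hne, hu, hv, huv | hvu | ⟨w, hw, huw, hvw⟩⟩
    · exact ⟨hne, hu, hv, v, hv, Or.inr huv, Or.inl rfl⟩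
    · exact ⟨hne, hu, hv, u, hu, Or.inl rfl, Or.inr hvu⟩
    · exact ⟨hne, hu, hv, w, hw, Or.inr huw, Or.inr hvw⟩
  · rintro ⟨hne, hu, hv, w, hw, rfl | huw, rfl | hvw⟩
    · exact absurd rfl hne
    · exact ⟨hne, hu, hv, Or.inr (Or.inl hvw)⟩
    · exact ⟨hne, hu, hv, Or.inl huw⟩
    · exact ⟨hne, hu, hv, Or.inr (Or.inr ⟨w, hw, huw, hvw⟩)⟩

theorem moralOn_mono (G : Dag V) {U W : Set V} (h : U ⊆ W) : G.moralOn U ≤ G.moralOn W :=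
  fun _ _ ⟨hne, hu, hv, huv⟩ => ⟨hne, h hu, h hv, huv.imp_right <| Or.imp_right
    fun ⟨w, hw, hadj⟩ => ⟨w, h hw, hadj⟩⟩

end Dag

section Separation

variable {V : Type*} {M N : SimpleGraph V} {y : V}

theorem separatedBy_anti (h : M ≤ N) {A B C : Set V} (hN : N.SeparatedBy A B C) :
    M.SeparatedBy A B C := fun a ha b hb p => by
  simpa only [SimpleGraph.Walk.support_mapLe_eq_support] using hN a ha b hb (p.mapLe h)

/-- The walk is rerouted around `y`; for the induction, one that starts at `y` is allowed to lose
its first vertex. -/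
theorem exists_walk_support_subset_of_isClique_neighborSet
    (hy : M.IsClique (M.neighborSet y)) (hMN : ∀ u v, M.Adj u v → u ≠ y → v ≠ y → N.Adj u v)
    {a b : V} (hb : b ≠ y) (p : M.Walk a b) :
    ∃ a', (a' = a ∨ a = y ∧ M.Adj y a') ∧ a' ≠ y ∧
      ∃ q : N.Walk a' b, q.support ⊆ p.support := by
  induction p with
  | nil => exact ⟨_, Or.inl rfl, hb, .nil, List.Subset.refl _⟩
  | @cons a c b hac p ih =>
    obtain ⟨c', hc', hc'y, q, hq⟩ := ih hb
    have hq' : q.support ⊆ (p.cons hac).support := List.Subset.trans hq (List.subset_cons_self ..)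
    have extend (hac' : N.Adj a c') : ∃ q : N.Walk a b, q.support ⊆ (p.cons hac).support :=
      ⟨q.cons hac', List.cons_subset_cons _ hq⟩
    by_cases hay : a = y
    · subst hay
      obtain rfl : c' = c := hc'.resolve_right fun h => hac.ne h.1.symm
      exact ⟨c', Or.inr ⟨rfl, hac⟩, hc'y, q, hq'⟩
    obtain rfl | ⟨rfl, hyc'⟩ := hc'
    · exact ⟨a, Or.inl rfl, hay, extend (hMN _ _ hac hay hc'y)⟩
    by_cases hac' : a = c'
    · subst hac'
      exact ⟨a, Or.inl rfl, hay, q, hq'⟩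
    · exact ⟨a, Or.inl rfl, hay, extend (hMN _ _ (hy hac.symm hyc' hac') hay hc'y)⟩

theorem separatedBy_of_isClique_neighborSet
    (hy : M.IsClique (M.neighborSet y)) (hMN : ∀ u v, M.Adj u v → u ≠ y → v ≠ y → N.Adj u v)
    {A B C : Set V} (hA : y ∉ A) (hB : y ∉ B) (hN : N.SeparatedBy A B C) :
    M.SeparatedBy A B C := by
  intro a ha b hb p
  obtain ⟨a', ha', -, q, hq⟩ := exists_walk_support_subset_of_isClique_neighborSet hy hMN
    (ne_of_mem_of_not_mem hb hB) p
  obtain rfl : a' = a := ha'.resolve_right fun h => hA (h.1 ▸ ha)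
  obtain ⟨c, hc, hcq⟩ := hN a' ha b hb q
  exact ⟨c, hc, hq hcq⟩

end Separation

namespace Dag

variable {V : Type*} {G H : Dag V}

theorem separatedBy_moralOn_insert {U : Set V} {x y : V} (hU : G.IsAncestral U) (hx : x ∈ U)
    (hy : y ∉ U) (hxy : G.parents y = insert x (G.parents x)) {A B C : Set V} (hA : A ⊆ U)
    (hB : B ⊆ U) (h : (G.moralOn U).SeparatedBy A B C) :
    (G.moralOn (insert y U)).SeparatedBy A B C := by
  have mem_parents : ∀ u ∈ (G.moralOn (insert y U)).neighborSet y, u ∈ G.parents y := by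
    intro u hu
    obtain ⟨hne, -, -, w, rfl | hw, hyw, huw⟩ := moralOn_adj_iff.1 hu
    · exact huw.resolve_left hne.symm
    · exact absurd (hU.insert_parents_subset hw hyw) hy
  refine separatedBy_of_isClique_neighborSet (fun u hu v hv hne => ?_) (fun u v huv huy hvy => ?_)
    (fun h => hy (hA h)) (fun h => hy (hB h)) h
  · exact moralOn_adj_iff.2 ⟨hne, hu.2.2.1, hv.2.2.1, y, Set.mem_insert y U,
      Or.inr (mem_parents u hu), Or.inr (mem_parents v hv)⟩
  · obtain ⟨hne, hu, hv, w, rfl | hw, huw, hvw⟩ := moralOn_adj_iff.1 huv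
    · refine moralOn_adj_iff.2 ⟨hne, hu.resolve_left huy, hv.resolve_left hvy, x, hx, ?_⟩
      exact hxy ▸ ⟨huw.resolve_left huy, hvw.resolve_left hvy⟩
    · exact moralOn_adj_iff.2
        ⟨hne, hu.resolve_left huy, hv.resolve_left hvy, w, hw, huw, hvw⟩

/-! ### Reversal of covered arrows -/

/-- `H` arises from `G` by the reversal of the arrow `x → y`, which is covered in `G`: the parents
of `y` are `x` and the parents of `x`. The relational form makes the symmetry in `G` and `H`
visible. -/
structure CoveredFlip (G H : Dag V) (x y : V) : Prop where
  parents_eq_insert : G.parents y = insert x (G.parents x)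
  parents_head : H.parents y = G.parents x
  parents_tail : H.parents x = insert y (G.parents x)
  parents_other : ∀ v, v ≠ x → v ≠ y → H.parents v = G.parents v

namespace CoveredFlip

variable {x y : V}

theorem adj (h : G.CoveredFlip H x y) : G.Adj x y :=
  h.parents_eq_insert.ge (Set.mem_insert x _)

theorem symm (h : G.CoveredFlip H x y) : H.CoveredFlip G y x where
  parents_eq_insert := by rw [h.parents_tail, h.parents_head]
  parents_head := h.parents_head.symm
  parents_tail := by rw [h.parents_eq_insert, h.parents_head]
  parents_other v hy hx := (h.parents_other v hx hy).symm

theorem adj_or_eq (h : G.CoveredFlip H x y) {u v : V} (huv : H.Adj u v) :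
    G.Adj u v ∨ u = y ∧ v = x := by
  change u ∈ H.parents v at huv
  by_cases hvx : v = x
  · subst hvx
    rw [h.parents_tail] at huv
    exact huv.symm.imp_right fun huy => ⟨huy, rfl⟩
  by_cases hvy : v = y
  · subst hvy
    rw [h.parents_head] at huv
    exact Or.inl (h.parents_eq_insert.ge (Or.inr huv))
  · exact Or.inl ((h.parents_other v hvx hvy).le huv)

theorem isAncestral (h : G.CoveredFlip H x y) {U : Set V} (hU : G.IsAncestral U)
    (hxy : x ∈ U → y ∈ U) : H.IsAncestral U := by
  intro v hv u huv
  obtain huv | ⟨rfl, rfl⟩ := h.adj_or_eq huv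
  exacts [hU v hv huv, hxy hv]

theorem moralOn_le (h : G.CoveredFlip H x y) {U : Set V} (hxy : x ∈ U → y ∈ U) :
    H.moralOn U ≤ G.moralOn U := by
  intro u v huv
  rw [moralOn_adj_iff] at huv ⊢
  obtain ⟨hne, hu, hv, w, hw, huw, hvw⟩ := huv
  refine ⟨hne, hu, hv, ?_⟩
  by_cases hwx : w = x
  · subst hwx
    refine ⟨y, hxy hw, ?_⟩
    rw [h.parents_eq_insert, Set.insert_comm, ← h.parents_tail]
    exact ⟨huw, hvw⟩
  by_cases hwy : w = y
  · subst hwy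
    refine ⟨w, hw, ?_⟩
    rw [h.parents_eq_insert, Set.insert_comm, ← h.parents_head]
    exact ⟨Or.inr huw, Or.inr hvw⟩
  · rw [h.parents_other w hwx hwy] at huw hvw
    exact ⟨w, hw, huw, hvw⟩

/-- If the ancestral hull contains `x` but not `y`, it is not ancestral in `H`; the insertion of `y`
repairs this and does not affect separation. -/
theorem semigraphoid_subset (h : G.CoveredFlip H x y) : G.semigraphoid ⊆ H.semigraphoid := by
  rintro ⟨A, B, C⟩ hG
  set S := A ∪ B ∪ C
  set U := G.ancestralHull S
  have hU : G.IsAncestral U := G.isAncestral_ancestralHull S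
  have hSU : S ⊆ U := G.subset_ancestralHull S
  obtain ⟨W, hW, hSW, hxy, hsep⟩ : ∃ W, G.IsAncestral W ∧ S ⊆ W ∧ (x ∈ W → y ∈ W) ∧
      (G.moralOn W).SeparatedBy A B C := by
    by_cases hxy : x ∈ U → y ∈ U
    · exact ⟨U, hU, hSU, hxy, hG⟩
    obtain ⟨hx, hy⟩ := Classical.not_imp.1 hxy
    have hyU : G.IsAncestral (insert y U) := by
      rintro v (rfl | hv)
      · rw [h.parents_eq_insert]
        exact (hU.insert_parents_subset hx).trans (Set.subset_insert _ _)
      · exact (hU v hv).trans (Set.subset_insert _ _)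
    exact ⟨insert y U, hyU, hSU.trans (Set.subset_insert y U), fun _ => Set.mem_insert y U,
      separatedBy_moralOn_insert hU hx hy h.parents_eq_insert
        (fun a ha => hSU (Or.inl (Or.inl ha))) (fun b hb => hSU (Or.inl (Or.inr hb))) hG⟩
  exact separatedBy_anti ((H.moralOn_mono (ancestralHull_subset (h.isAncestral hW hxy) hSW)).trans
    (h.moralOn_le hxy)) hsep

theorem semigraphoid_eq (h : G.CoveredFlip H x y) : G.semigraphoid = H.semigraphoid :=
  h.semigraphoid_subset.antisymm h.symm.semigraphoid_subset

theorem dCliqueVector_eq [Fintype V] (h : G.CoveredFlip H x y) :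
    G.dCliqueVector = H.dCliqueVector := by
  classical
  have hyx : y ∈ Finset.univ.erase x :=
    Finset.mem_erase.2 ⟨fun hyx => G.irrefl x (hyx ▸ h.adj), Finset.mem_univ y⟩
  have hother : ∀ v ∈ (Finset.univ.erase x).erase y, H.parents v = G.parents v := fun v hv =>
    h.parents_other v (Finset.ne_of_mem_erase (Finset.mem_of_mem_erase hv))
      (Finset.ne_of_mem_erase hv)
  simp only [dCliqueVector, ← Finset.add_sum_erase _ _ (Finset.mem_univ x),
    ← Finset.add_sum_erase _ _ hyx]
  rw [Finset.sum_congr rfl fun v hv => by rw [← hother v hv], h.parents_eq_insert, h.parents_head,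
    h.parents_tail, Set.insert_comm]
  abel

end CoveredFlip

/-- In the new order, `y` is moved to the place immediately before `x`. -/
theorem exists_coveredFlip {x y : V} (hxy : G.parents y = insert x (G.parents x)) :
    ∃ H, G.CoveredFlip H x y := by
  classical
  have hadj : G.Adj x y := hxy.ge (Set.mem_insert x _)
  have hne : y ≠ x := by
    rintro rfl
    exact G.irrefl _ hadj
  let P : V → Set V :=
    Function.update (Function.update G.parents y (G.parents x)) x (insert y (G.parents x))
  have hPx : P x = insert y (G.parents x) := Function.update_self ..
  have hPy : P y = G.parents x := by simp [P, hne]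
  have hP {v : V} (hvx : v ≠ x) (hvy : v ≠ y) : P v = G.parents v := by simp [P, hvx, hvy]
  let pos : V → V × Bool := fun v => if v = y then (x, false) else (v, true)
  have hpos {v : V} (hv : v ≠ y) : pos v = (v, true) := if_neg hv
  have hposy : pos y = (x, false) := if_pos rfl
  have before {u v : V} (huv : G.Adj u v) : Relation.TransGen G.Adj (pos u).1 v := by
    by_cases huy : u = y
    · subst huy
      rw [hposy]
      exact .tail (.single hadj) huv
    · rw [hpos huy]
      exact .single huv
  have pos_lt {u v : V} (huv : u ∈ P v) :
      Prod.Lex (Relation.TransGen G.Adj) (· < ·) (pos u) (pos v) := by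
    by_cases hvy : v = y
    · subst hvy
      rw [hPy] at huv
      rw [hposy]
      exact Prod.Lex.left _ _ (before huv)
    rw [hpos hvy]
    by_cases hvx : v = x
    · subst hvx
      obtain rfl | huv := hPx.le huv
      · rw [hposy]
        exact Prod.Lex.right _ Bool.false_lt_true
      · exact Prod.Lex.left _ _ (before huv)
    · exact Prod.Lex.left _ _ (before ((hP hvx hvy).le huv))
  exact ⟨ofWellFounded (fun u v => u ∈ P v) (Subrelation.wf pos_lt
    (InvImage.wf pos (G.wellFounded_adj.transGen.prod_lex wellFounded_lt))), hxy, hPy, hPx,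
    fun v hvx hvy => hP hvx hvy⟩


/-! ### Patterns and Markov equivalence -/

/-- The undirected graph that underlies a DAG. -/
def skeleton (G : Dag V) : SimpleGraph V where
  Adj u v := G.Adj u v ∨ G.Adj v u
  symm := ⟨fun _ _ => Or.symm⟩
  loopless := ⟨fun u h => h.elim (G.irrefl u) (G.irrefl u)⟩

/-- An immorality, or v-structure: two arrows `u → w ← v` whose tails are distinct and not joined
in the skeleton. -/
def Immorality (G : Dag V) (u w v : V) : Prop :=
  G.Adj u w ∧ G.Adj v w ∧ u ≠ v ∧ ¬ G.skeleton.Adj u v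

/-- Equality of the patterns of two DAGs, i.e. of their skeletons and their immoralities; for
finite DAGs this characterizes Markov equivalence. -/
structure SamePattern (G H : Dag V) : Prop where
  skeleton_eq : G.skeleton = H.skeleton
  immorality_iff : ∀ u w v, G.Immorality u w v ↔ H.Immorality u w v

theorem SamePattern.symm (h : G.SamePattern H) : H.SamePattern G :=
  ⟨h.skeleton_eq.symm, fun u w v => (h.immorality_iff u w v).symm⟩

theorem SamePattern.trans {K : Dag V} (h : G.SamePattern H) (h' : H.SamePattern K) :
    G.SamePattern K :=
  ⟨h.skeleton_eq.trans h'.skeleton_eq,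
    fun u w v => (h.immorality_iff u w v).trans (h'.immorality_iff u w v)⟩

theorem SamePattern.adj_of_adj_of_not_adj (h : G.SamePattern H) {u v : V} (huv : G.Adj u v)
    (hvu : ¬ H.Adj v u) : H.Adj u v :=
  (h.skeleton_eq.le (Or.inl huv)).resolve_right hvu

theorem moralOn_adj_of_skeleton_adj {U : Set V} {u v : V} (h : G.skeleton.Adj u v) (hu : u ∈ U)
    (hv : v ∈ U) : (G.moralOn U).Adj u v :=
  ⟨h.ne, hu, hv, h.imp_right Or.inl⟩

theorem notMem_semigraphoid_of_skeleton_adj {u v : V} (h : G.skeleton.Adj u v) {C : Set V}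
    (hu : u ∉ C) (hv : v ∉ C) : ({u}, {v}, C) ∉ G.semigraphoid := by
  let U := G.ancestralHull ({u} ∪ {v} ∪ C)
  intro (hsep : (G.moralOn U).SeparatedBy {u} {v} C)
  have hsub : {u} ∪ {v} ∪ C ⊆ U := G.subset_ancestralHull _
  have huv : (G.moralOn U).Adj u v :=
    moralOn_adj_of_skeleton_adj h (hsub (by simp)) (hsub (by simp))
  obtain ⟨c, hc, hcp⟩ := hsep u rfl v rfl huv.toWalk
  obtain rfl | rfl : c = u ∨ c = v := by simpa [SimpleGraph.Adj.toWalk] using hcp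
  exacts [hu hc, hv hc]

theorem mem_semigraphoid_of_not_skeleton_adj {u v : V} (hne : u ≠ v) (h : ¬ G.skeleton.Adj u v) :
    ({u}, {v}, G.ancestralHull {u, v} \ {u, v}) ∈ G.semigraphoid := by
  have hunion : ({u} : Set V) ∪ {v} ∪ G.ancestralHull {u, v} \ {u, v} = G.ancestralHull {u, v} := by
    rw [Set.singleton_union, Set.union_sdiff_cancel (G.subset_ancestralHull {u, v})]
  rw [semigraphoid, Set.mem_ofPred_eq, hunion,
    (G.isAncestral_ancestralHull {u, v}).ancestralHull_eq]
  rintro a rfl b rfl p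
  cases p with
  | nil => exact absurd rfl hne
  | @cons _ c _ hac p =>
    refine ⟨c, ⟨hac.2.2.1, ?_⟩, by simp⟩
    rintro (rfl | rfl)
    · exact hac.ne rfl
    obtain hac | hca | ⟨w, hw, haw, hcw⟩ := hac.2.2.2
    · exact h (Or.inl hac)
    · exact h (Or.inr hca)
    · exact notMem_ancestralHull_pair haw hcw hw

theorem skeleton_adj_iff {u v : V} :
    G.skeleton.Adj u v ↔ u ≠ v ∧ ∀ C : Set V, u ∉ C → v ∉ C → ({u}, {v}, C) ∉ G.semigraphoid := by
  refine ⟨fun h => ⟨h.ne, fun C => notMem_semigraphoid_of_skeleton_adj h⟩, fun ⟨hne, hsep⟩ => ?_⟩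
  by_contra h
  exact hsep _ (by simp) (by simp) (mem_semigraphoid_of_not_skeleton_adj hne h)

theorem notMem_semigraphoid_of_noncollider {u v w : V} {C : Set V} (hu : u ∉ C) (hv : v ∉ C)
    (hw : w ∉ C) (huw : G.skeleton.Adj u w) (hwv : G.skeleton.Adj w v)
    (h : G.Adj w u ∨ G.Adj w v) : ({u}, {v}, C) ∉ G.semigraphoid := by
  let U := G.ancestralHull ({u} ∪ {v} ∪ C)
  intro (hsep : (G.moralOn U).SeparatedBy {u} {v} C)
  have hU : G.IsAncestral U := G.isAncestral_ancestralHull _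
  have huU : u ∈ U := G.subset_ancestralHull _ (by simp)
  have hvU : v ∈ U := G.subset_ancestralHull _ (by simp)
  have hwU : w ∈ U := h.elim (fun hwu => hU u huU hwu) (fun hwv => hU v hvU hwv)
  have huw' : (G.moralOn U).Adj u w := moralOn_adj_of_skeleton_adj huw huU hwU
  have hwv' : (G.moralOn U).Adj w v := moralOn_adj_of_skeleton_adj hwv hwU hvU
  obtain ⟨c, hc, hcp⟩ := hsep u rfl v rfl (hwv'.toWalk.cons huw')
  obtain rfl | rfl | rfl : c = u ∨ c = w ∨ c = v := by simpa [SimpleGraph.Adj.toWalk] using hcp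
  exacts [hu hc, hw hc, hv hc]

theorem immorality_iff {u w v : V} :
    G.Immorality u w v ↔ u ≠ v ∧ ¬ G.skeleton.Adj u v ∧ G.skeleton.Adj u w ∧ G.skeleton.Adj w v ∧
      ∃ C : Set V, u ∉ C ∧ v ∉ C ∧ w ∉ C ∧ ({u}, {v}, C) ∈ G.semigraphoid := by
  constructor
  · rintro ⟨huw, hvw, hne, huv⟩
    exact ⟨hne, huv, Or.inl huw, Or.inr hvw, _, by simp, by simp,
      fun hw => notMem_ancestralHull_pair huw hvw hw.1,
      mem_semigraphoid_of_not_skeleton_adj hne huv⟩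
  · rintro ⟨hne, huv, huw, hwv, C, huC, hvC, hwC, hsep⟩
    obtain ⟨hwu, hwv'⟩ : ¬ G.Adj w u ∧ ¬ G.Adj w v := not_or.1 fun h =>
      notMem_semigraphoid_of_noncollider huC hvC hwC huw hwv h hsep
    exact ⟨huw.resolve_right hwu, hwv.resolve_left hwv', hne, huv⟩

theorem samePattern_of_semigraphoid_eq (h : G.semigraphoid = H.semigraphoid) :
    G.SamePattern H := by
  have skeleton_eq : G.skeleton = H.skeleton := by
    ext u v
    rw [skeleton_adj_iff, skeleton_adj_iff, h]
  exact ⟨skeleton_eq, fun u w v => by rw [immorality_iff, immorality_iff, h, skeleton_eq]⟩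

theorem SamePattern.exists_adj_adj_of_ne (h : G.SamePattern H) (hne : G ≠ H) :
    ∃ u v, G.Adj u v ∧ H.Adj v u := by
  by_contra! hrev
  have adj_of_adj {u v : V} (huv : G.Adj u v) : H.Adj u v :=
    h.adj_of_adj_of_not_adj huv (hrev u v huv)
  refine hne (ext_parents fun v => Set.ext fun u => ⟨adj_of_adj, fun huv => ?_⟩)
  exact h.symm.adj_of_adj_of_not_adj huv fun hvu => hrev v u hvu huv

/-- Among the arrows that `H` reverses, one whose head comes first and whose tail comes last in `G`
is covered. -/
theorem SamePattern.exists_covered [Finite V] (h : G.SamePattern H) (hne : G ≠ H) :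
    ∃ x y, H.Adj y x ∧ G.parents y = insert x (G.parents x) := by
  obtain ⟨u, v, huv⟩ := h.exists_adj_adj_of_ne hne
  obtain ⟨y, hy, hmin⟩ := G.wellFounded_adj.has_min {y | ∃ x, G.Adj x y ∧ H.Adj y x} ⟨v, u, huv⟩
  obtain ⟨x, ⟨hxy, hyx⟩, hmax⟩ := G.wellFounded_flip_adj.has_min {x | G.Adj x y ∧ H.Adj y x} hy
  have kept {z w : V} (hwz : G.Adj w z) (hzy : G.Adj z y) : H.Adj w z :=
    h.adj_of_adj_of_not_adj hwz fun hzw => hmin z ⟨w, hwz, hzw⟩ hzy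
  refine ⟨x, y, hyx, Set.Subset.antisymm (fun z hzy => ?_) (Set.insert_subset hxy fun z hzx => ?_)⟩
  · by_cases hzx : z = x
    · exact Or.inl hzx
    have hadj : G.skeleton.Adj z x := by
      by_contra hn
      exact H.asymm hyx ((h.immorality_iff z y x).1 ⟨hzy, hxy, hzx, hn⟩).2.1
    refine Or.inr (hadj.resolve_right fun hxz => ?_)
    have hzy' : H.Adj z y := h.adj_of_adj_of_not_adj hzy fun hyz => hmax z ⟨hzy, hyz⟩ hxz
    exact H.not_adj_of_adj_of_adj hzy' hyx (kept hxz hzy)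
  · have hne : z ≠ y := by
      rintro rfl
      exact G.asymm hxy hzx
    have hadj : G.skeleton.Adj z y := by
      by_contra hn
      have himm : H.Immorality z x y := ⟨kept hzx hxy, hyx, hne, h.skeleton_eq ▸ hn⟩
      exact G.asymm hxy ((h.immorality_iff z x y).2 himm).2.1
    exact hadj.resolve_right (G.not_adj_of_adj_of_adj hzx hxy)

theorem CoveredFlip.ncard_reversed_lt [Finite V] {K : Dag V} {x y : V} (h : G.CoveredFlip K x y)
    (hyx : H.Adj y x) : {p : V × V | K.Adj p.1 p.2 ∧ ¬ H.Adj p.1 p.2}.ncard <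
      {p : V × V | G.Adj p.1 p.2 ∧ ¬ H.Adj p.1 p.2}.ncard := by
  refine Set.ncard_lt_ncard ⟨?_, fun hsub => ?_⟩
  · rintro ⟨u, v⟩ ⟨huv, hH⟩
    refine ⟨(h.adj_or_eq huv).resolve_right ?_, hH⟩
    rintro ⟨rfl, rfl⟩
    exact hH hyx
  · have hxy : K.Adj x y := (@hsub (x, y) ⟨h.adj, H.asymm hyx⟩).1
    exact K.asymm hxy h.symm.adj

theorem SamePattern.apply_eq [Finite V] {α : Type*} (F : Dag V → α)
    (hF : ∀ (G H : Dag V) (x y : V), G.CoveredFlip H x y → F G = F H) {G H : Dag V}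
    (h : G.SamePattern H) : F G = F H := by
  induction hn : {p : V × V | G.Adj p.1 p.2 ∧ ¬ H.Adj p.1 p.2}.ncard using Nat.strong_induction_on
    generalizing G with
  | _ n ih =>
    by_cases hne : G = H
    · rw [hne]
    obtain ⟨x, y, hyx, hcovered⟩ := h.exists_covered hne
    obtain ⟨K, hK⟩ := exists_coveredFlip hcovered
    have hKH : K.SamePattern H := (samePattern_of_semigraphoid_eq hK.semigraphoid_eq).symm.trans h
    exact (hF G K x y hK).trans (ih _ (hn ▸ hK.ncard_reversed_lt hyx) hKH rfl)

/-- The theorem of Verma and Pearl. -/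
theorem equiv_iff_samePattern [Finite V] : G ≈ H ↔ G.SamePattern H :=
  ⟨samePattern_of_semigraphoid_eq, fun h => h.apply_eq semigraphoid
    fun _ _ _ _ => CoveredFlip.semigraphoid_eq⟩

theorem dCliqueVector_eq_of_equiv [Fintype V] (h : G ≈ H) : G.dCliqueVector = H.dCliqueVector :=
  (equiv_iff_samePattern.1 h).apply_eq dCliqueVector fun _ _ _ _ => CoveredFlip.dCliqueVector_eq

/-! ### Insertion into an ancestral set -/

section Insertion

variable {A : Set V} (K : Dag A) (hG : G.IsAncestral A)

theorem insertion_adj_of_mem {u v : V} (hv : v ∈ A) :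
    (K.insertion G hG).Adj u v ↔ ∃ hu : u ∈ A, K.Adj ⟨u, hu⟩ ⟨v, hv⟩ := by
  constructor
  · rintro (⟨hu, _, huv⟩ | ⟨huv, hn⟩)
    · exact ⟨hu, huv⟩
    · exact absurd ⟨hG v hv huv, hv⟩ hn
  · exact fun ⟨hu, huv⟩ => Or.inl ⟨hu, hv, huv⟩

theorem insertion_adj_of_notMem {u v : V} (hv : v ∉ A) :
    (K.insertion G hG).Adj u v ↔ G.Adj u v := by
  constructor
  · rintro (⟨-, hv', -⟩ | ⟨huv, -⟩)
    · exact absurd hv' hv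
    · exact huv
  · exact fun huv => Or.inr ⟨huv, fun h => hv h.2⟩

theorem parents_insertion_of_mem {v : V} (hv : v ∈ A) :
    (K.insertion G hG).parents v = Subtype.val '' K.parents ⟨v, hv⟩ := by
  ext u
  refine (insertion_adj_of_mem K hG hv).trans ?_
  simp only [parents, Set.mem_image, Set.mem_ofPred_eq, Subtype.exists, exists_and_right,
    exists_eq_right]

theorem parents_insertion_of_notMem {v : V} (hv : v ∉ A) :
    (K.insertion G hG).parents v = G.parents v :=
  Set.ext fun _ => insertion_adj_of_notMem K hG hv

theorem isAncestral_insertion : (K.insertion G hG).IsAncestral A :=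
  fun _ hv _ huv => ((insertion_adj_of_mem K hG hv).1 huv).1

theorem insertion_insertion (L : Dag A) :
    L.insertion (K.insertion G hG) (isAncestral_insertion K hG) = L.insertion G hG := by
  refine ext_parents fun v => ?_
  by_cases hv : v ∈ A
  · rw [parents_insertion_of_mem _ _ hv, parents_insertion_of_mem _ _ hv]
  · rw [parents_insertion_of_notMem _ _ hv, parents_insertion_of_notMem _ _ hv,
      parents_insertion_of_notMem _ _ hv]

theorem induce_insertion : (K.insertion G hG).induce A = K :=
  ext_parents fun v => Set.ext fun u =>
    (insertion_adj_of_mem K hG v.2).trans (exists_prop_of_true u.2)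

theorem parents_insertion_induce_of_mem (hH : H.IsAncestral A) {v : V} (hv : v ∈ A) :
    ((H.induce A).insertion G hG).parents v = H.parents v :=
  Set.ext fun _ => (insertion_adj_of_mem _ hG hv).trans
    ⟨fun h => h.2, fun huv => ⟨hH v hv huv, huv⟩⟩

theorem insertion_induce_self : (G.induce A).insertion G hG = G := by
  refine ext_parents fun v => ?_
  by_cases hv : v ∈ A
  · exact parents_insertion_induce_of_mem hG hG hv
  · exact parents_insertion_of_notMem _ hG hv

/-- An exchange of the subgraphs on `A` in `G` and `H` permutes the parent sets of each vertex. -/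
theorem sum_parents_insertion_add [Fintype V] {M : Type*} [AddCommMonoid M] (F : V → Set V → M)
    (hH : H.IsAncestral A) :
    ∑ v, F v (((H.induce A).insertion G hG).parents v) +
        ∑ v, F v (((G.induce A).insertion H hH).parents v) =
      ∑ v, F v (G.parents v) + ∑ v, F v (H.parents v) := by
  rw [← Finset.sum_add_distrib, ← Finset.sum_add_distrib]
  refine Finset.sum_congr rfl fun v _ => ?_
  by_cases hv : v ∈ A
  · rw [parents_insertion_induce_of_mem hG hH hv, parents_insertion_induce_of_mem hH hG hv,
      add_comm]
  · rw [parents_insertion_of_notMem _ hG hv, parents_insertion_of_notMem _ hH hv]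

theorem skeleton_insertion_adj_iff {u v : V} : (K.insertion G hG).skeleton.Adj u v ↔
    (∃ (hu : u ∈ A) (hv : v ∈ A), K.skeleton.Adj ⟨u, hu⟩ ⟨v, hv⟩) ∨
      (G.skeleton.Adj u v ∧ ¬ (u ∈ A ∧ v ∈ A)) := by
  simp only [skeleton, insertion]
  by_cases hu : u ∈ A <;> by_cases hv : v ∈ A <;> simp [hu, hv]

theorem immorality_insertion_of_mem {u w v : V} (hw : w ∈ A) :
    (K.insertion G hG).Immorality u w v ↔
      ∃ (hu : u ∈ A) (hv : v ∈ A), K.Immorality ⟨u, hu⟩ ⟨w, hw⟩ ⟨v, hv⟩ := by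
  simp only [Immorality, insertion_adj_of_mem K hG hw, skeleton_insertion_adj_iff]
  by_cases hu : u ∈ A <;> by_cases hv : v ∈ A <;> simp [hu, hv]

theorem immorality_insertion_of_notMem_of_mem {u w v : V} (hw : w ∉ A) (hu : u ∈ A) (hv : v ∈ A) :
    (K.insertion G hG).Immorality u w v ↔
      G.Adj u w ∧ G.Adj v w ∧ u ≠ v ∧ ¬ K.skeleton.Adj ⟨u, hu⟩ ⟨v, hv⟩ := by
  simp [Immorality, insertion_adj_of_notMem K hG hw, skeleton_insertion_adj_iff, hu, hv]

theorem immorality_insertion_of_notMem {u w v : V} (hw : w ∉ A) (huv : ¬ (u ∈ A ∧ v ∈ A)) :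
    (K.insertion G hG).Immorality u w v ↔ G.Immorality u w v := by
  have hskel : (K.insertion G hG).skeleton.Adj u v ↔ G.skeleton.Adj u v := by
    rw [skeleton_insertion_adj_iff, and_iff_left huv, or_iff_right]
    exact fun ⟨hu, hv, _⟩ => huv ⟨hu, hv⟩
  simp only [Immorality, insertion_adj_of_notMem K hG hw, hskel]

end Insertion

theorem immorality_induce_iff {A : Set V} {u w v : A} :
    (G.induce A).Immorality u w v ↔ G.Immorality u w v := by
  simp only [Immorality, ne_eq, Subtype.ext_iff]
  rfl

theorem SamePattern.induce (h : G.SamePattern H) (A : Set V) :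
    (G.induce A).SamePattern (H.induce A) := by
  refine ⟨?_, fun u w v => ?_⟩
  · exact congrArg (SimpleGraph.comap Subtype.val) h.skeleton_eq
  · rw [immorality_induce_iff, immorality_induce_iff, h.immorality_iff]

theorem SamePattern.adj_iff_of_mem_of_notMem {A : Set V} (h : G.SamePattern H)
    (hG : G.IsAncestral A) (hH : H.IsAncestral A) {u w : V} (hu : u ∈ A) (hw : w ∉ A) :
    G.Adj u w ↔ H.Adj u w :=
  ⟨fun huw => h.adj_of_adj_of_not_adj huw fun hwu => hw (hH u hu hwu),
    fun huw => h.symm.adj_of_adj_of_not_adj huw fun hwu => hw (hG u hu hwu)⟩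

theorem SamePattern.insertion {A : Set V} {K L : Dag A} (hG : G.IsAncestral A)
    (hH : H.IsAncestral A) (hKL : K.SamePattern L) (hGH : G.SamePattern H) :
    (K.insertion G hG).SamePattern (L.insertion H hH) := by
  constructor
  · ext u v
    rw [skeleton_insertion_adj_iff, skeleton_insertion_adj_iff, hKL.skeleton_eq, hGH.skeleton_eq]
  intro u w v
  by_cases hw : w ∈ A
  · simp only [immorality_insertion_of_mem _ _ hw, hKL.immorality_iff]
  by_cases huv : u ∈ A ∧ v ∈ A
  · obtain ⟨hu, hv⟩ := huv
    rw [immorality_insertion_of_notMem_of_mem _ _ hw hu hv,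
      immorality_insertion_of_notMem_of_mem _ _ hw hu hv,
      hGH.adj_iff_of_mem_of_notMem hG hH hu hw, hGH.adj_iff_of_mem_of_notMem hG hH hv hw,
      hKL.skeleton_eq]
  · rw [immorality_insertion_of_notMem _ _ hw huv, immorality_insertion_of_notMem _ _ hw huv,
      hGH.immorality_iff]

/-! ### Complete subgraphs and deletion of arrows -/

/-- The DAG that is complete on `A` and in which all other vertices are isolated; in particular,
`completeOn ∅` has no arrows. -/
def completeOn (A : Set V) : Dag V where
  Adj u v := u ∈ A ∧ v ∈ A ∧ WellOrderingRel u v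
  acyclic := ⟨WellOrderingRel, inferInstance, fun _ _ h => h.2.2⟩

theorem skeleton_completeOn_adj_iff {A : Set V} {u v : V} :
    (completeOn A).skeleton.Adj u v ↔ u ≠ v ∧ u ∈ A ∧ v ∈ A := by
  constructor
  · intro h
    refine ⟨h.ne, ?_⟩
    obtain ⟨hu, hv, -⟩ | ⟨hv, hu, -⟩ := h <;> exact ⟨hu, hv⟩
  · rintro ⟨hne, hu, hv⟩
    obtain huv | huv | hvu := trichotomous_of WellOrderingRel u v
    · exact Or.inl ⟨hu, hv, huv⟩
    · exact absurd huv hne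
    · exact Or.inr ⟨hv, hu, hvu⟩

theorem samePattern_completeOn {A : Set V}
    (hG : ∀ u v, G.skeleton.Adj u v ↔ u ≠ v ∧ u ∈ A ∧ v ∈ A) : G.SamePattern (completeOn A) := by
  have moral {K : Dag V} (hK : ∀ u v, K.skeleton.Adj u v ↔ u ≠ v ∧ u ∈ A ∧ v ∈ A) (u w v : V) :
      ¬ K.Immorality u w v := fun ⟨huw, hvw, hne, huv⟩ =>
    huv ((hK u v).2 ⟨hne, ((hK u w).1 (Or.inl huw)).2.1, ((hK v w).1 (Or.inl hvw)).2.1⟩)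
  refine ⟨?_, fun u w v => iff_of_false (moral hG u w v)
    (moral (fun _ _ => skeleton_completeOn_adj_iff) u w v)⟩
  ext u v
  rw [hG, skeleton_completeOn_adj_iff]

theorem parents_completeOn_of_notMem {A : Set V} {v : V} (hv : v ∉ A) :
    (completeOn A).parents v = ∅ :=
  Set.eq_empty_of_forall_notMem fun _ h => hv h.2.1

theorem isAncestral_completeOn_compl_singleton {A : Set V} {v : V} (hv : v ∉ A) :
    (completeOn A).IsAncestral {v}ᶜ :=
  isAncestral_compl_singleton_iff.2 fun _ h => hv h.1

/-- The deletion of all arrows into `v`. -/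
def eraseParents (G : Dag V) (v : V) : Dag V where
  Adj u w := G.Adj u w ∧ w ≠ v
  acyclic :=
    have ⟨r, hr, h⟩ := G.acyclic
    ⟨r, hr, fun u w huw => h u w huw.1⟩

theorem parents_eraseParents_self (G : Dag V) (v : V) : (G.eraseParents v).parents v = ∅ :=
  Set.eq_empty_of_forall_notMem fun _ h => h.2 rfl

theorem parents_eraseParents_of_ne {v w : V} (hw : w ≠ v) :
    (G.eraseParents v).parents w = G.parents w :=
  Set.ext fun _ => and_iff_left hw

theorem eraseParents_eq_self {v : V} (hv : G.parents v = ∅) : G.eraseParents v = G := by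
  refine ext_parents fun w => ?_
  by_cases hw : w = v
  · rw [hw, parents_eraseParents_self, hv]
  · exact parents_eraseParents_of_ne hw

theorem insertion_induce_completeOn_parents {v : V} (hG : G.IsAncestral {v}ᶜ)
    (hK : (completeOn (G.parents v)).IsAncestral {v}ᶜ) :
    (G.induce {v}ᶜ).insertion (completeOn (G.parents v)) hK = G.eraseParents v := by
  have hv : v ∉ ({v}ᶜ : Set V) := Set.notMem_compl_iff.2 rfl
  have hpv : v ∉ G.parents v := G.irrefl v
  refine ext_parents fun w => ?_
  by_cases hw : w = v
  · rw [hw, parents_insertion_of_notMem _ _ hv,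
      parents_completeOn_of_notMem hpv, parents_eraseParents_self]
  · rw [parents_insertion_induce_of_mem _ hG hw, parents_eraseParents_of_ne hw]

theorem samePattern_insertion_induce_completeOn_parents {v : V} (hG : G.IsAncestral {v}ᶜ) :
    (((completeOn (G.parents v)).induce {v}ᶜ).insertion G hG).SamePattern
      (completeOn (insert v (G.parents v))) := by
  have adj_iff (u : V) : G.skeleton.Adj u v ↔ u ∈ G.parents v :=
    or_iff_left (isAncestral_compl_singleton_iff.1 hG u)
  have skeleton_induce_adj_iff (u w : ({v}ᶜ : Set V)) :
      ((completeOn (G.parents v)).induce {v}ᶜ).skeleton.Adj u w ↔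
        u.1 ≠ w.1 ∧ u.1 ∈ G.parents v ∧ w.1 ∈ G.parents v :=
    skeleton_completeOn_adj_iff
  refine samePattern_completeOn fun u w => ?_
  simp only [skeleton_insertion_adj_iff, skeleton_induce_adj_iff]
  by_cases hu : u = v <;> by_cases hw : w = v
  · simp [hu, hw]
  · simp [hu, hw, Ne.symm hw, G.skeleton.adj_comm v, adj_iff]
  · simp [hu, hw, adj_iff]
  · simp [hu, hw]

theorem exists_isAncestral_compl_singleton_of_ne [Finite V] (h : G ≠ completeOn ∅) :
    ∃ v, G.IsAncestral {v}ᶜ ∧ (G.parents v).Nonempty := by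
  have hne : {v | (G.parents v).Nonempty}.Nonempty := by
    by_contra! hempty
    refine h (ext_parents fun v => ?_)
    rw [parents_completeOn_of_notMem (Set.notMem_empty v)]
    exact Set.not_nonempty_iff_eq_empty.1 (Set.ext_iff.1 hempty v).1
  obtain ⟨v, hv, hmax⟩ := G.wellFounded_flip_adj.has_min _ hne
  exact ⟨v, isAncestral_compl_singleton_iff.2 fun w hvw => hmax w ⟨v, hvw⟩ hvw, hv⟩

theorem ncard_eraseParents_lt [Finite V] {v : V} (hv : (G.parents v).Nonempty) :
    {w | ((G.eraseParents v).parents w).Nonempty}.ncard < {w | (G.parents w).Nonempty}.ncard := by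
  refine Set.ncard_lt_ncard ⟨fun w ⟨u, huw, _⟩ => ⟨u, huw⟩, fun hsub => ?_⟩
  obtain ⟨u, -, hvv⟩ := hsub hv
  exact hvv rfl

/-- Successive deletion of the arrows into the vertices without children leads from `G` to the DAG
without arrows. -/
theorem apply_eq_add_sum_parents [Fintype V] {M : Type*} [AddCommGroup M] {F : Dag V → M}
    {ψ : V → Set V → M} (h : ∀ (G : Dag V) (v : V), G.IsAncestral {v}ᶜ →
      F G = F (G.eraseParents v) + ψ v (G.parents v)) (G : Dag V) :
    F G = F (completeOn ∅) + ∑ v, ψ v (G.parents v) := by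
  classical
  have hψ (v : V) : ψ v ∅ = 0 := by
    have hv : v ∉ (∅ : Set V) := Set.notMem_empty v
    have := h (completeOn ∅) v (isAncestral_completeOn_compl_singleton hv)
    rwa [parents_completeOn_of_notMem hv, eraseParents_eq_self (parents_completeOn_of_notMem hv),
      left_eq_add] at this
  induction hn : {v | (G.parents v).Nonempty}.ncard using Nat.strong_induction_on
    generalizing G with
  | _ n ih =>
    by_cases hG : G = completeOn ∅
    · simp only [hG, parents_completeOn_of_notMem (Set.notMem_empty _), hψ, Finset.sum_const_zero,
        add_zero]
    obtain ⟨v, hanc, hv⟩ := exists_isAncestral_compl_singleton_of_ne hG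
    have hsum : ∑ w, ψ w ((G.eraseParents v).parents w) =
        ∑ w ∈ Finset.univ.erase v, ψ w (G.parents w) := by
      rw [← Finset.add_sum_erase _ _ (Finset.mem_univ v), parents_eraseParents_self, hψ, zero_add]
      exact Finset.sum_congr rfl fun w hw => by
        rw [parents_eraseParents_of_ne (Finset.ne_of_mem_erase hw)]
    rw [h G v hanc, ih _ (hn ▸ ncard_eraseParents_lt hv) _ rfl, hsum, add_assoc,
      Finset.sum_erase_add _ _ (Finset.mem_univ v)]

theorem sum_mul_dCliqueVector [Fintype V] {R : Type*} [Ring R] (ω : Set V → R) (G : Dag V) :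
    ∑ A, ω A * (G.dCliqueVector A : R) =
      ∑ v, (ω (insert v (G.parents v)) - ω (G.parents v)) + ω ∅ := by
  classical
  have hsingle (B : Set V) : ∑ A, ω A * ((Pi.single B (1 : ℤ) : Set V → ℤ) A : R) = ω B := by
    rw [Finset.sum_eq_single B] <;> simp +contextual
  simp only [dCliqueVector, Pi.add_apply, Finset.sum_apply, Pi.sub_apply, Int.cast_add,
    Int.cast_sum, Int.cast_sub, mul_add, Finset.mul_sum, mul_sub, Finset.sum_add_distrib, hsingle]
  rw [Finset.sum_comm]
  simp only [Finset.sum_sub_distrib, hsingle]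

end Dag

namespace Dagoid

variable {V : Type*}

instance [Finite V] : Finite (Dagoid V) := inferInstanceAs (Finite (Quotient (Dag.markovSetoid V)))

instance : DiscreteMeasurableSpace (Dagoid V) := ⟨fun _ => trivial⟩

theorem mk_eq_mk_iff [Finite V] {G H : Dag V} : mk G = mk H ↔ G.SamePattern H :=
  Quotient.eq.trans Dag.equiv_iff_samePattern

theorem dCliqueVector_mk [Fintype V] (G : Dag V) : (mk G).dCliqueVector = G.dCliqueVector :=
  Dag.dCliqueVector_eq_of_equiv (Quotient.mk_out G)

variable {A : Set V}

theorem mk_rep (D : ances A) : mk (rep D) = D.1 := D.2.choose_spec.1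

theorem mk_mem_ances {G : Dag V} (hG : G.IsAncestral A) : mk G ∈ ances A :=
  ⟨G, rfl, hG⟩

/-- The dagoid whose remainder is that of `D` and whose subdagoid on `A` is that of `D'`. -/
noncomputable def splice (D D' : ances A) : ances A :=
  ⟨mk (((rep D').induce A).insertion (rep D) (isAncestral_rep D)),
    mk_mem_ances (Dag.isAncestral_insertion _ _)⟩

variable [Finite V]

theorem induced_mk {G : Dag V} (hG : G.IsAncestral A) :
    induced ⟨mk G, mk_mem_ances hG⟩ = mk (G.induce A) :=
  mk_eq_mk_iff.2 ((mk_eq_mk_iff.1 (mk_rep ⟨mk G, mk_mem_ances hG⟩)).induce A)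

theorem mk_insertion_congr {K L : Dag A} {G H : Dag V} (hG : G.IsAncestral A)
    (hH : H.IsAncestral A) (hKL : mk K = mk L) (hGH : mk G = mk H) :
    mk (K.insertion G hG) = mk (L.insertion H hH) :=
  mk_eq_mk_iff.2 (.insertion hG hH (mk_eq_mk_iff.1 hKL) (mk_eq_mk_iff.1 hGH))

theorem remainder_mk {G : Dag V} (hG : G.IsAncestral A) :
    remainder ⟨mk G, mk_mem_ances hG⟩ = mk ((Dag.complete A).insertion G hG) :=
  mk_insertion_congr _ _ rfl (mk_rep ⟨mk G, mk_mem_ances hG⟩)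

theorem remainder_splice (D D' : ances A) : remainder (splice D D') = remainder D := by
  rw [splice, remainder_mk (Dag.isAncestral_insertion _ _), Dag.insertion_insertion]
  rfl

theorem induced_splice (D D' : ances A) : induced (splice D D') = induced D' := by
  rw [splice, induced_mk (Dag.isAncestral_insertion _ _), Dag.induce_insertion]
  rfl

theorem splice_mk {G H : Dag V} (hG : G.IsAncestral A) (hH : H.IsAncestral A) :
    (splice ⟨mk G, mk_mem_ances hG⟩ ⟨mk H, mk_mem_ances hH⟩).1 =
      mk ((H.induce A).insertion G hG) :=
  mk_insertion_congr _ _ (induced_mk hH) (mk_rep _)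

theorem eq_of_remainder_eq_of_induced_eq {D D' : ances A} (hrem : remainder D = remainder D')
    (hind : induced D = induced D') : D = D' := by
  have key := mk_insertion_congr (Dag.isAncestral_insertion (Dag.complete A) (isAncestral_rep D))
    (Dag.isAncestral_insertion (Dag.complete A) (isAncestral_rep D')) hind hrem
  rw [Dag.insertion_insertion, Dag.insertion_insertion, Dag.insertion_induce_self,
    Dag.insertion_induce_self, mk_rep, mk_rep] at key
  exact Subtype.ext key

end Dagoid

/-! ### Independence as a cross-product relation -/

section Independence

open MeasureTheory ProbabilityTheory

variable {X Y Z : Type*} [MeasurableSpace X] [MeasurableSpace Y] [MeasurableSpace Z]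
  {f : X → Y} {g : X → Z} {σ : X → X → X}

theorem cross_mul_of_indepFun [MeasurableSingletonClass Y] [MeasurableSingletonClass Z]
    {μ : Measure X} (hf : ∀ x x', f (σ x x') = f x) (hg : ∀ x x', g (σ x x') = g x')
    (hinj : ∀ x x', f x = f x' → g x = g x' → x = x') (h : IndepFun f g μ) (x x' : X) :
    μ {x} * μ {x'} = μ {σ x x'} * μ {σ x' x} := by
  have measure_singleton (z : X) : μ {z} = μ (f ⁻¹' {f z}) * μ (g ⁻¹' {g z}) := by
    rw [← h.measure_inter_preimage_eq_mul _ _ (.singleton _) (.singleton _)]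
    congr 1
    ext w
    exact ⟨fun hw => hw ▸ ⟨rfl, rfl⟩, fun hw => hinj w z hw.1 hw.2⟩
  simp only [measure_singleton, hf, hg]
  ring

variable [DiscreteMeasurableSpace X]

theorem comap_cond_apply (μ : Measure X) (s : Set X) (t : Set s) :
    (μ[|s]).comap Subtype.val t = μ[Subtype.val '' t|s] :=
  (MeasurableEmbedding.subtype_coe .of_discrete).comap_apply _ _

theorem isZeroOrProbabilityMeasure_comap_cond (μ : Measure X) [IsFiniteMeasure μ] (s : Set X) :
    IsZeroOrProbabilityMeasure ((μ[|s]).comap (Subtype.val : s → X)) := by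
  rw [isZeroOrProbabilityMeasure_iff, comap_cond_apply, Subtype.coe_image_univ]
  by_cases hs : μ s = 0
  · exact Or.inl (by simp [cond_eq_zero_of_meas_eq_zero hs])
  · exact Or.inr (cond_apply_self hs (measure_ne_top μ s))

variable [Countable X]

/-- The involution `(x, x') ↦ (σ x x', σ x' x)` preserves the product measure and carries
`(f ⁻¹' s ∩ g ⁻¹' t) × X` to `f ⁻¹' s × g ⁻¹' t`. -/
theorem indepFun_of_cross_mul (μ : Measure X) [IsZeroOrProbabilityMeasure μ]
    (hf : ∀ x x', f (σ x x') = f x) (hg : ∀ x x', g (σ x x') = g x')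
    (hinj : ∀ x x', f x = f x' → g x = g x' → x = x')
    (h : ∀ x x', μ {x} * μ {x'} = μ {σ x x'} * μ {σ x' x}) : IndepFun f g μ := by
  rw [indepFun_iff_measure_inter_preimage_eq_mul]
  intro s t _ _
  obtain rfl | hμ := eq_zero_or_isProbabilityMeasure μ
  · simp
  let τ : X × X → X × X := fun p => (σ p.1 p.2, σ p.2 p.1)
  have τ_involutive : Function.Involutive τ := fun p => Prod.ext
    (hinj _ _ (by rw [hf, hf]) (by rw [hg, hg])) (hinj _ _ (by rw [hf, hf]) (by rw [hg, hg]))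
  have τ_preserving : (μ.prod μ).map τ = μ.prod μ := by
    refine Measure.ext_of_singleton fun p => ?_
    have hpre : τ ⁻¹' {p} = {τ p} := by
      ext q
      exact τ_involutive.eq_iff
    rw [Measure.map_apply .of_discrete .of_discrete, hpre, ← Set.singleton_prod_singleton,
      ← Set.singleton_prod_singleton, Measure.prod_prod, Measure.prod_prod, h p.1 p.2]
  have hpre : τ ⁻¹' ((f ⁻¹' s ∩ g ⁻¹' t) ×ˢ Set.univ) = (f ⁻¹' s) ×ˢ (g ⁻¹' t) := by
    ext p
    simp [τ, hf, hg]
  calc μ (f ⁻¹' s ∩ g ⁻¹' t) = μ.prod μ ((f ⁻¹' s ∩ g ⁻¹' t) ×ˢ Set.univ) := by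
        rw [Measure.prod_prod, measure_univ, mul_one]
    _ = μ.prod μ ((f ⁻¹' s) ×ˢ (g ⁻¹' t)) := by
        rw [← hpre, ← Measure.map_apply .of_discrete .of_discrete, τ_preserving]
    _ = μ (f ⁻¹' s) * μ (g ⁻¹' t) := Measure.prod_prod _ _

theorem indepFun_iff_cross_mul [MeasurableSingletonClass Y] [MeasurableSingletonClass Z]
    (μ : Measure X) [IsZeroOrProbabilityMeasure μ]
    (hf : ∀ x x', f (σ x x') = f x) (hg : ∀ x x', g (σ x x') = g x')
    (hinj : ∀ x x', f x = f x' → g x = g x' → x = x') :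
    IndepFun f g μ ↔ ∀ x x', μ {x} * μ {x'} = μ {σ x x'} * μ {σ x' x} :=
  ⟨cross_mul_of_indepFun hf hg hinj, indepFun_of_cross_mul μ hf hg hinj⟩

theorem indepFun_comap_cond_iff_cross_mul [MeasurableSingletonClass Y] [MeasurableSingletonClass Z]
    (p : PMF X) {s : Set X} {f : s → Y} {g : s → Z} {σ : s → s → s}
    (hf : ∀ x x', f (σ x x') = f x) (hg : ∀ x x', g (σ x x') = g x')
    (hinj : ∀ x x', f x = f x' → g x = g x' → x = x') :
    IndepFun f g ((p.toMeasure[|s]).comap Subtype.val) ↔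
      ∀ x x' : s, p x * p x' = p (σ x x') * p (σ x' x) := by
  let μ := p.toMeasure
  have : IsZeroOrProbabilityMeasure ((μ[|s]).comap Subtype.val) :=
    isZeroOrProbabilityMeasure_comap_cond μ s
  have inter_singleton (x : s) : s ∩ Subtype.val '' {x} = {x.1} := by
    rw [Set.image_singleton, Set.inter_eq_right.2 (Set.singleton_subset_iff.2 x.2)]
  have cond_eq (x : s) : (μ[|s]).comap Subtype.val {x} = (μ s)⁻¹ * p x := by
    rw [comap_cond_apply, cond_apply .of_discrete, inter_singleton,
      PMF.toMeasure_apply_singleton _ _ .of_discrete]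
  have eq_mul_cond (x : s) : p x = (μ[|s]).comap Subtype.val {x} * μ s := by
    rw [comap_cond_apply, cond_mul_eq_inter .of_discrete, inter_singleton,
      PMF.toMeasure_apply_singleton _ _ .of_discrete]
  rw [indepFun_iff_cross_mul _ hf hg hinj]
  constructor <;> intro h x x'
  · rw [eq_mul_cond x, eq_mul_cond x', mul_mul_mul_comm, h, mul_mul_mul_comm, ← eq_mul_cond,
      ← eq_mul_cond]
  · rw [cond_eq x, cond_eq x', mul_mul_mul_comm, h, mul_mul_mul_comm, ← cond_eq, ← cond_eq]

end Independence

/-! ### Structurally Markov graph laws -/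

section GraphLaw

open Dagoid

variable {V : Type*}

theorem isStructurallyMarkov_iff_cross_mul [Finite V] {law : PMF (Dagoid V)} :
    IsStructurallyMarkov law ↔ ∀ (A : Set V) (G H : Dag V) (hG : G.IsAncestral A)
      (hH : H.IsAncestral A), law (mk G) * law (mk H) =
        law (mk ((H.induce A).insertion G hG)) * law (mk ((G.induce A).insertion H hH)) := by
  refine forall_congr' fun A => ?_
  rw [indepFun_comap_cond_iff_cross_mul law remainder_splice induced_splice
    fun _ _ => eq_of_remainder_eq_of_induced_eq]
  constructor
  · intro h G H hG hH
    rw [← splice_mk hG hH, ← splice_mk hH hG]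
    exact h ⟨mk G, mk_mem_ances hG⟩ ⟨mk H, mk_mem_ances hH⟩
  · intro h D D'
    rw [← mk_rep D, ← mk_rep D']
    exact h (rep D) (rep D') (isAncestral_rep D) (isAncestral_rep D')

theorem IsStructurallyMarkov.law_mul_law_completeOn [Finite V] {law : PMF (Dagoid V)}
    (h : IsStructurallyMarkov law) {G : Dag V} {v : V} (hG : G.IsAncestral {v}ᶜ) :
    law (mk G) * law (mk (Dag.completeOn (G.parents v))) =
      law (mk (Dag.completeOn (insert v (G.parents v)))) * law (mk (G.eraseParents v)) := by
  have hK : (Dag.completeOn (G.parents v)).IsAncestral {v}ᶜ :=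
    Dag.isAncestral_completeOn_compl_singleton (G.irrefl v)
  rw [isStructurallyMarkov_iff_cross_mul.1 h {v}ᶜ G _ hG hK,
    Dag.insertion_induce_completeOn_parents hG hK,
    mk_eq_mk_iff.2 (Dag.samePattern_insertion_induce_completeOn_parents hG)]

/-- The natural parameter `ω` of a structurally Markov graph law: `ω A` is the log-probability of
the dagoid that is complete on `A` and has no other edges. -/
noncomputable def cliqueParameter (law : PMF (Dagoid V)) (A : Set V) : ℝ :=
  Real.log (law (mk (Dag.completeOn A))).toReal

theorem toReal_law_pos {law : PMF (Dagoid V)} (hsupp : law.support = Set.univ) (D : Dagoid V) :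
    0 < (law D).toReal :=
  ENNReal.toReal_pos ((law.mem_support_iff D).1 (hsupp ▸ Set.mem_univ D)) (law.apply_ne_top D)

theorem IsStructurallyMarkov.log_law_mk [Finite V] {law : PMF (Dagoid V)}
    (h : IsStructurallyMarkov law) (hsupp : law.support = Set.univ) {G : Dag V} {v : V}
    (hG : G.IsAncestral {v}ᶜ) : Real.log (law (mk G)).toReal =
      Real.log (law (mk (G.eraseParents v))).toReal +
        (cliqueParameter law (insert v (G.parents v)) - cliqueParameter law (G.parents v)) := by
  have hlog := congrArg (fun x => Real.log x.toReal) (h.law_mul_law_completeOn hG)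
  have hne (D : Dagoid V) : (law D).toReal ≠ 0 := (toReal_law_pos hsupp D).ne'
  simp only [ENNReal.toReal_mul, Real.log_mul (hne _) (hne _)] at hlog
  simp only [cliqueParameter]
  linarith

theorem IsStructurallyMarkov.log_law [Fintype V] {law : PMF (Dagoid V)}
    (h : IsStructurallyMarkov law) (hsupp : law.support = Set.univ) (D : Dagoid V) :
    Real.log (law D).toReal = ∑ A, cliqueParameter law A * (D.dCliqueVector A : ℝ) := by
  obtain ⟨G, rfl⟩ : ∃ G, mk G = D := Quotient.exists_rep D
  rw [dCliqueVector_mk, Dag.sum_mul_dCliqueVector, add_comm]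
  exact Dag.apply_eq_add_sum_parents (F := fun G => Real.log (law (mk G)).toReal)
    (ψ := fun v P => cliqueParameter law (insert v P) - cliqueParameter law P)
    (fun _ _ => h.log_law_mk hsupp) G

theorem IsStructurallyMarkov.isDCliqueExponential [Fintype V] {law : PMF (Dagoid V)}
    (h : IsStructurallyMarkov law) (hsupp : law.support = Set.univ) :
    IsDCliqueExponential law := by
  refine ⟨cliqueParameter law, 1, one_pos, fun D => ?_⟩
  rw [← h.log_law hsupp, Real.exp_log (toReal_law_pos hsupp D), one_mul]

theorem IsDCliqueExponential.isStructurallyMarkov [Fintype V] {law : PMF (Dagoid V)}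
    (h : IsDCliqueExponential law) : IsStructurallyMarkov law := by
  obtain ⟨ω, c, -, hlaw⟩ := h
  rw [isStructurallyMarkov_iff_cross_mul]
  intro A G H hG hH
  have hsum := Dag.sum_parents_insertion_add hG (fun v P => ω (insert v P) - ω P) hH
  rw [← ENNReal.toReal_eq_toReal_iff'
    (ENNReal.mul_ne_top (law.apply_ne_top _) (law.apply_ne_top _))
    (ENNReal.mul_ne_top (law.apply_ne_top _) (law.apply_ne_top _))]
  simp only [ENNReal.toReal_mul, hlaw, dCliqueVector_mk, Dag.sum_mul_dCliqueVector]
  rw [mul_mul_mul_comm, mul_mul_mul_comm c (Real.exp _) c, ← Real.exp_add, ← Real.exp_add]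
  congr 2
  linarith

end GraphLaw

theorem mainTheorem2 {V : Type*} [Fintype V] (law : PMF (Dagoid V))
    (hsupp : law.support = Set.univ) :
    IsStructurallyMarkov law ↔ IsDCliqueExponential law :=
  ⟨fun h => h.isDCliqueExponential hsupp, IsDCliqueExponential.isStructurallyMarkov⟩
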